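/- Let $\kappa>0$ and let $\theta:\mathbb R\to\mathbb R$ be given by $\theta(x)=e^{-x^{-\kappa}}$ for $x>0$ and $\theta(x)=0$ for $x\le 0$. Then $\theta$ is $C^\infty$ and of Gevrey class of order $s=1+1/\kappa$ (that is, there are constants $M,R>0$ with $|\theta^{(j)}(x)|\le M\,R^j (j!)^s$ for all $j\ge 0$ and $x\in\mathbb R$), but $\theta$ is not real-analytic at $0$. Let $p\ge 1$ be real and consider, for $h>0$, the triangular system $$hW'=\mathcal A(x,h)W,\qquad \mathcal A(x,h)=\begin{pmatrix} x+i & h^p\theta(x)\\ 0&-(x+i)\end{pmatrix},\qquad W\in\mathbb C^2 .$$ For no $L>0$ does this system possess a uniformly bounded $C^1$ conjugator on $[-L,L]$ as $h\to0^+$: there do not exist $h_0>0$, a constant $C$ and invertible matrices $T(x,h)\in\mathbb C^{2\times 2}$ ($x\in[-L,L]$, $0<h\le h_0$) such that, for every $h\in(0,h_0]$, $T(\cdot,h)$ is $C^1$ on $[-L,L]$, all entries of $T(x,h)$ and $T(x,h)^{-1}$ are bounded by $C$ in absolute value for all $x\in[-L,L]$, and the change of coordinates $W=TZ$ converts the system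 on $[-L,L]$ to a diagonal system $hZ'=D(x,h)Z$ (that is, $W=TZ$ solves the triangular system if and only if $Z$ solves $hZ'=DZ$, with $D(x,h)$ diagonal). In particular there is none for which $T$ and $T^{-1}$ are bounded in $C^1([-L,L])$ uniformly in $h$. -/

import Mathlib

open scoped Nat

noncomputable section

namespace SemiclassicalConjugator

/-- The flat function `exp (-x ^ (-κ))` for `x > 0`, extended by `0` to `x ≤ 0`. -/
def flatFun (κ : ℝ) (x : ℝ) : ℝ :=
  if 0 < x then Real.exp (-(x ^ (-κ))) else 0

/-- `f : ℝ → ℝ` is of Gevrey class of order `s`, uniformly on the line: it is smooth and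
`|f⁽ʲ⁾(x)| ≤ C Tʲ (j!)ˢ` for all `j` and `x`, with constants `C` and `T` independent of `j`, `x`. -/
def IsGevrey (s : ℝ) (f : ℝ → ℝ) : Prop :=
  ContDiff ℝ (⊤ : ℕ∞) f ∧
    ∃ C T : ℝ, 0 < T ∧ ∀ (j : ℕ) (x : ℝ), |iteratedDeriv j f x| ≤ C * T ^ j * ((j ! : ℕ) : ℝ) ^ s

/-- The coefficient matrix of the triangular system, with diagonal entries `x + i`, `-(x + i)` and
upper right entry `h ^ p θ(x)`; here `h > 0` is the semiclassical parameter. -/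
def triangularCoeff (p : ℝ) (θ : ℝ → ℝ) (h x : ℝ) : Matrix (Fin 2) (Fin 2) ℂ :=
  !![(x : ℂ) + Complex.I, ((h ^ p * θ x : ℝ) : ℂ);
     0, -((x : ℂ) + Complex.I)]

/-- `W` is a (classical) solution of `h W' = M(x) W` on the interval `[-L, L]`
(with one-sided derivatives at the end points). -/
def SolvesOn (h L : ℝ) (M : ℝ → Matrix (Fin 2) (Fin 2) ℂ) (W : ℝ → Fin 2 → ℂ) : Prop :=
  ∀ x ∈ Set.Icc (-L) L, ∃ W' : Fin 2 → ℂ,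
    HasDerivWithinAt W W' (Set.Icc (-L) L) x ∧ (h : ℂ) • W' = (M x).mulVec (W x)

/-- The change of coordinates `W = T Z` converts `h W' = M(x) W` on `[-L, L]` to `h Z' = D(x) Z`. -/
def ConvertsOn (h L : ℝ) (M D T : ℝ → Matrix (Fin 2) (Fin 2) ℂ) : Prop :=
  ∀ Z : ℝ → Fin 2 → ℂ,
    SolvesOn h L M (fun x => (T x).mulVec (Z x)) ↔ SolvesOn h L D Z

/-- The family `T h x`, `0 < h ≤ h₀`, `x ∈ [-L, L]`, is a uniformly bounded `C¹` conjugator on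
`[-L, L]` for the family of systems `h W' = A(x, h) W`: for each `h` the matrix `T h x` is
invertible and `C¹` in `x`, the coordinate change `W = T Z` converts the system to an exactly
diagonal one, and `T` and `T⁻¹` are bounded uniformly in `x` and `h`.
(No regularity in `h`, and no bound on the `x`-derivatives of `T` that is uniform in `h`, is asked
for: every family for which `T` and `T⁻¹` are uniformly bounded in `C¹` is included.) -/
structure IsBoundedC1Conjugator (A : ℝ → ℝ → Matrix (Fin 2) (Fin 2) ℂ) (L h₀ : ℝ)
    (T : ℝ → ℝ → Matrix (Fin 2) (Fin 2) ℂ) : Prop where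
  contDiffOn : ∀ h ∈ Set.Ioc 0 h₀, ∀ i j, ContDiffOn ℝ 1 (fun x => T h x i j) (Set.Icc (-L) L)
  invertible : ∀ h ∈ Set.Ioc 0 h₀, ∀ x ∈ Set.Icc (-L) L, IsUnit (T h x)
  bounded : ∃ C : ℝ, ∀ h ∈ Set.Ioc 0 h₀, ∀ x ∈ Set.Icc (-L) L, ∀ i j,
    ‖T h x i j‖ ≤ C ∧ ‖(T h x)⁻¹ i j‖ ≤ C
  diagonalizes : ∀ h ∈ Set.Ioc 0 h₀, ∃ D : ℝ → Matrix (Fin 2) (Fin 2) ℂ,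
    (∀ x ∈ Set.Icc (-L) L, (D x).IsDiag) ∧ ConvertsOn h L (A h) D (T h)

end SemiclassicalConjugator

end

noncomputable section

namespace SemiclassicalConjugator

/-! ### Regularity of the flat function -/

/-! Gevrey regularity comes from Cauchy estimates: `flatExt` is holomorphic on discs about `x > 0`
of radius proportional to `x`, and is there at most `exp (-x ^ (-κ) / 2)`. This factor absorbs the
resulting powers of `1/x` at the cost of `(j!) ^ (1/κ)`.

For the non-existence, a conjugator bounded by `C` yields two solutions, one for each diagonal
coordinate, whose component products are at most `2 C⁴` times their Wronskian
(`exists_transversal_solutions`). Upper components carry the factor `growth`, whose square has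
modulus `exp (L² / h)` at `±L`. Comparing the solutions at `-L`, `0` and `L` therefore forces the
connection coefficient `h ^ (p - 1) * oscPrimitive θ h⁻¹ L` to be `O(exp (-L² / h))`
(`norm_connection_le_of_conjugator`).

With `t = 1/h`, the transform `∫ θ(y) exp (-t (y² + 2iy)) dy` over `(0, L]` would then decay
exponentially. Integrating it against `t ^ n` bounds the moments of `θ` against powers of `phaseInv
= 1 / (y² + 2iy)` geometrically, and an algebraic recurrence transfers this to the moments of `θ`
against `y⁻ⁿ`. Since `θ > 0` on `(0, ∞)`, those moments outgrow every geometric sequence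
(`not_forall_norm_integral_le`). -/

lemma flatFun_of_pos {κ x : ℝ} (hx : 0 < x) : flatFun κ x = Real.exp (-(x ^ (-κ))) := if_pos hx

lemma flatFun_of_nonpos {κ x : ℝ} (hx : x ≤ 0) : flatFun κ x = 0 := if_neg hx.not_gt

lemma flatFun_nonneg (κ x : ℝ) : 0 ≤ flatFun κ x := by
  unfold flatFun
  split_ifs <;> positivity

lemma flatFun_le_one (κ x : ℝ) : flatFun κ x ≤ 1 := by
  rcases le_or_gt x 0 with hx | hx
  · simp [flatFun_of_nonpos hx]
  · rw [flatFun_of_pos hx, Real.exp_le_one_iff]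
    have := Real.rpow_nonneg hx.le (-κ)
    linarith

/-- Negative powers are dominated by the flat exponential, with Gevrey type constants. -/
lemma inv_pow_mul_exp_le {κ : ℝ} (hκ : 0 < κ) {x : ℝ} (hx : 0 < x) (m : ℕ) :
    x⁻¹ ^ m * Real.exp (-(x ^ (-κ)) / 2) ≤
      ((m ! : ℕ) : ℝ) ^ (1 / κ) * ((2 / κ) ^ (1 / κ)) ^ m := by
  set t := x ^ (-κ) with ht
  have ht0 : 0 < t := Real.rpow_pos_of_pos hx _
  -- The weight `κ / 2` makes the exponential become exactly `exp (t / 2)` once the inequality is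
  -- raised to the power `1 / κ`.
  have h1 : (κ / 2 * t) ^ m ≤ (m ! : ℕ) * Real.exp (κ / 2 * t) := by
    have h := Real.pow_div_factorial_le_exp (κ / 2 * t) (by positivity) m
    rw [div_le_iff₀ (by positivity)] at h
    linarith
  have h2 : ((κ / 2 * t) ^ m) ^ (1 / κ) ≤ ((m ! : ℕ) : ℝ) ^ (1 / κ) * Real.exp (t / 2) := by
    refine (Real.rpow_le_rpow (by positivity) h1 (by positivity)).trans_eq ?_
    rw [Real.mul_rpow (by positivity) (by positivity), ← Real.exp_mul]
    congr 2
    field_simp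
  have hxinv : x⁻¹ = (2 / κ) ^ (1 / κ) * (κ / 2 * t) ^ (1 / κ) := by
    rw [← Real.mul_rpow (by positivity) (by positivity)]
    have : 2 / κ * (κ / 2 * t) = t := by field_simp
    rw [this, ht, ← Real.rpow_mul hx.le, ← Real.rpow_neg_one]
    congr 1
    field_simp
  have h3 : x⁻¹ ^ m = ((2 / κ) ^ (1 / κ)) ^ m * ((κ / 2 * t) ^ m) ^ (1 / κ) := by
    rw [hxinv, mul_pow, ← Real.rpow_natCast ((κ / 2 * t) ^ (1 / κ)), ← Real.rpow_mul (by positivity),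
      ← Real.rpow_natCast (κ / 2 * t), ← Real.rpow_mul (by positivity), mul_comm (1 / κ)]
  calc x⁻¹ ^ m * Real.exp (-t / 2)
      = ((2 / κ) ^ (1 / κ)) ^ m * ((κ / 2 * t) ^ m) ^ (1 / κ) * Real.exp (-t / 2) := by rw [h3]
    _ ≤ ((2 / κ) ^ (1 / κ)) ^ m * (((m ! : ℕ) : ℝ) ^ (1 / κ) * Real.exp (t / 2)) *
        Real.exp (-t / 2) := by gcongr
    _ = ((m ! : ℕ) : ℝ) ^ (1 / κ) * ((2 / κ) ^ (1 / κ)) ^ m *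
        (Real.exp (t / 2) * Real.exp (-t / 2)) := by ring
    _ = _ := by rw [← Real.exp_add]; simp [neg_div]

/-- The holomorphic extension of the flat function from the positive half-line. -/
def flatExt (κ : ℝ) (z : ℂ) : ℂ := Complex.exp (-(z ^ (-κ : ℂ)))

lemma flatExt_ofReal {κ x : ℝ} (hx : 0 < x) : flatExt κ x = flatFun κ x := by
  rw [flatFun_of_pos hx, flatExt]
  push_cast
  rw [Complex.ofReal_cpow hx.le]
  push_cast
  rfl

lemma differentiableOn_flatExt (κ : ℝ) : DifferentiableOn ℂ (flatExt κ) Complex.slitPlane := by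
  intro z hz
  unfold flatExt
  exact ((differentiableAt_id.cpow_const hz).neg.cexp).differentiableWithinAt

/-- Homogeneity, `(x w) ^ (-κ) = x ^ (-κ) * w ^ (-κ)` for `x > 0`, reduces the bound to `w` near
`1`, where continuity gives real part above `1/2`. Hence one ratio `r` serves every `x`. -/
lemma exists_norm_flatExt_le (κ : ℝ) : ∃ r : ℝ, 0 < r ∧ ∀ x : ℝ, 0 < x → ∀ z : ℂ,
    ‖z - x‖ ≤ r * x → z ∈ Complex.slitPlane ∧ ‖flatExt κ z‖ ≤ Real.exp (-(x ^ (-κ)) / 2) := by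
  have hc : ContinuousAt (fun w : ℂ => (w ^ (-κ : ℂ)).re) 1 :=
    Complex.continuous_re.continuousAt.comp
      (continuousAt_id.cpow continuousAt_const Complex.one_mem_slitPlane)
  have h1 : ∀ᶠ w : ℂ in nhds 1, 1 / 2 < (w ^ (-κ : ℂ)).re :=
    hc.eventually (lt_mem_nhds (by norm_num))
  have h2 : ∀ᶠ w : ℂ in nhds 1, w ∈ Complex.slitPlane :=
    Complex.isOpen_slitPlane.mem_nhds Complex.one_mem_slitPlane
  obtain ⟨ε, hε, hball⟩ := Metric.eventually_nhds_iff.1 (h1.and h2)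
  refine ⟨ε / 2, by positivity, fun x hx z hz => ?_⟩
  have hxc : (x : ℂ) ≠ 0 := by exact_mod_cast hx.ne'
  set w : ℂ := z / x with hw
  have hzw : z = x * w := by rw [hw]; field_simp
  have hd : dist w 1 < ε := by
    have : w - 1 = (z - x) / x := by rw [hw]; field_simp
    rw [dist_eq_norm, this, norm_div, Complex.norm_real, Real.norm_of_nonneg hx.le,
      div_lt_iff₀ hx]
    nlinarith
  obtain ⟨hre, hslit⟩ := hball hd
  have harg : z.arg = w.arg := by rw [hzw, Complex.arg_real_mul _ hx]
  constructor
  · rw [Complex.mem_slitPlane_iff_arg] at hslit ⊢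
    rw [harg, hzw]
    exact ⟨hslit.1, mul_ne_zero hxc hslit.2⟩
  · have key : (z ^ (-κ : ℂ)).re = x ^ (-κ) * (w ^ (-κ : ℂ)).re := by
      rw [show (-κ : ℂ) = ((-κ : ℝ) : ℂ) by push_cast; rfl, Complex.cpow_ofReal_re,
        Complex.cpow_ofReal_re, harg, hzw, norm_mul, Complex.norm_real,
        Real.norm_of_nonneg hx.le, Real.mul_rpow hx.le (norm_nonneg _), mul_assoc]
    rw [flatExt, Complex.norm_exp, Complex.neg_re, key]
    have := Real.rpow_pos_of_pos hx (-κ)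
    gcongr
    nlinarith

/-- The candidate for the `j`-th derivative of the flat function. -/
def flatDeriv (κ : ℝ) (j : ℕ) (x : ℝ) : ℝ :=
  if 0 < x then (iteratedDeriv j (flatExt κ) x).re else 0

/-- Cauchy's estimate on the circle of radius `r * x`; the constant produced is the inverse of that
ratio. -/
lemma exists_abs_flatDeriv_le (κ : ℝ) : ∃ r : ℝ, 0 < r ∧ ∀ (j : ℕ) (x : ℝ), 0 < x →
    |flatDeriv κ j x| ≤ (j ! : ℕ) * r ^ j * (x⁻¹ ^ j * Real.exp (-(x ^ (-κ)) / 2)) := by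
  obtain ⟨r, hr, H⟩ := exists_norm_flatExt_le κ
  refine ⟨r⁻¹, by positivity, fun j x hx => ?_⟩
  rw [flatDeriv, if_pos hx]
  refine (Complex.abs_re_le_norm _).trans ?_
  have hrx : 0 < r * x := by positivity
  have hsub : Metric.closedBall (x : ℂ) (r * x) ⊆ Complex.slitPlane := fun z hz =>
    (H x hx z (by rwa [Metric.mem_closedBall, dist_eq_norm] at hz)).1
  have hd : DiffContOnCl ℂ (flatExt κ) (Metric.ball (x : ℂ) (r * x)) := by
    apply DifferentiableOn.diffContOnCl
    rw [closure_ball _ hrx.ne']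
    exact (differentiableOn_flatExt κ).mono hsub
  refine (Complex.norm_iteratedDeriv_le_of_forall_mem_sphere_norm_le j hrx hd
    fun z hz => (H x hx z ?_).2).trans_eq ?_
  · rw [mem_sphere_iff_norm] at hz
    exact hz.le
  · rw [mul_pow, inv_pow, inv_pow]
    field_simp

lemma differentiableOn_iteratedDeriv_flatExt (κ : ℝ) (j : ℕ) :
    DifferentiableOn ℂ (iteratedDeriv j (flatExt κ)) Complex.slitPlane := by
  induction j with
  | zero => simpa using differentiableOn_flatExt κ
  | succ n ih =>
    rw [iteratedDeriv_succ]
    exact ih.deriv Complex.isOpen_slitPlane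

lemma hasDerivAt_flatDeriv {κ : ℝ} (hκ : 0 < κ) (j : ℕ) (x : ℝ) :
    HasDerivAt (flatDeriv κ j) (flatDeriv κ (j + 1) x) x := by
  rcases lt_trichotomy x 0 with hx | rfl | hx
  · have : flatDeriv κ j =ᶠ[nhds x] fun _ => 0 := by
      filter_upwards [Iio_mem_nhds hx] with y hy
      exact if_neg (Set.mem_Iio.1 hy).not_gt
    rw [flatDeriv, if_neg hx.not_gt]
    exact (hasDerivAt_const x (0 : ℝ)).congr_of_eventuallyEq this
  · obtain ⟨r, hr, H⟩ := exists_abs_flatDeriv_le κ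
    -- The index `j + 2` pays for the `j` inverse powers of Cauchy's estimate and leaves a factor `y
    -- ^ 2`, enough for a zero derivative at the origin.
    set B : ℝ := (j ! : ℕ) * r ^ j *
      ((((j + 2) ! : ℕ) : ℝ) ^ (1 / κ) * ((2 / κ) ^ (1 / κ)) ^ (j + 2)) with hB
    have hB0 : 0 ≤ B := by positivity
    have hbound : ∀ y : ℝ, |flatDeriv κ j y| ≤ B * y ^ 2 := by
      intro y
      rcases le_or_gt y 0 with hy | hy
      · rw [flatDeriv, if_neg hy.not_gt, abs_zero]
        positivity
      · refine (H j y hy).trans ?_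
        have h2 := inv_pow_mul_exp_le hκ hy (j + 2)
        have : y⁻¹ ^ j * Real.exp (-(y ^ (-κ)) / 2) =
            (y⁻¹ ^ (j + 2) * Real.exp (-(y ^ (-κ)) / 2)) * y ^ 2 := by
          rw [pow_add]
          field_simp
        rw [this, ← mul_assoc, hB]
        gcongr
    have h0 : ∀ k, flatDeriv κ k 0 = 0 := fun k => if_neg (lt_irrefl 0)
    rw [h0, hasDerivAt_iff_isLittleO, h0]
    have : (fun y : ℝ => flatDeriv κ j y - 0 - (y - 0) • (0 : ℝ)) =O[nhds 0]
        fun y : ℝ => y ^ 2 := by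
      refine Asymptotics.IsBigO.of_bound B (Filter.Eventually.of_forall fun y => ?_)
      simpa using hbound y
    refine this.trans_isLittleO ?_
    simpa using Asymptotics.isLittleO_pow_id (𝕜 := ℝ) (n := 2) (by norm_num)
  · have hs : (x : ℂ) ∈ Complex.slitPlane := Complex.ofReal_mem_slitPlane.2 hx
    have h1 : HasDerivAt (iteratedDeriv j (flatExt κ)) (iteratedDeriv (j + 1) (flatExt κ) x) x := by
      rw [iteratedDeriv_succ]
      exact ((differentiableOn_iteratedDeriv_flatExt κ j).differentiableAt
        (Complex.isOpen_slitPlane.mem_nhds hs)).hasDerivAt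
    have : flatDeriv κ j =ᶠ[nhds x] fun y : ℝ => (iteratedDeriv j (flatExt κ) y).re := by
      filter_upwards [Ioi_mem_nhds hx] with y hy
      exact if_pos hy
    rw [flatDeriv, if_pos hx]
    exact h1.real_of_complex.congr_of_eventuallyEq this

lemma iteratedDeriv_flatFun {κ : ℝ} (hκ : 0 < κ) (j : ℕ) :
    iteratedDeriv j (flatFun κ) = flatDeriv κ j := by
  induction j with
  | zero =>
    ext x
    rcases le_or_gt x 0 with hx | hx
    · simp [flatDeriv, hx.not_gt, flatFun_of_nonpos hx]
    · simp [flatDeriv, hx, flatExt_ofReal hx]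
  | succ n ih =>
    rw [iteratedDeriv_succ, ih]
    ext x
    exact (hasDerivAt_flatDeriv hκ n x).deriv

theorem contDiff_flatFun {κ : ℝ} (hκ : 0 < κ) : ContDiff ℝ (⊤ : ℕ∞) (flatFun κ) := by
  refine contDiff_of_differentiable_iteratedDeriv fun m _ => ?_
  rw [iteratedDeriv_flatFun hκ]
  exact fun x => (hasDerivAt_flatDeriv hκ m x).differentiableAt

theorem isGevrey_flatFun {κ : ℝ} (hκ : 0 < κ) : IsGevrey (1 + 1 / κ) (flatFun κ) := by
  obtain ⟨r, hr, H⟩ := exists_abs_flatDeriv_le κ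
  refine ⟨contDiff_flatFun hκ, 1, r * (2 / κ) ^ (1 / κ), by positivity, fun j x => ?_⟩
  rw [iteratedDeriv_flatFun hκ]
  rcases le_or_gt x 0 with hx | hx
  · rw [flatDeriv, if_neg hx.not_gt, abs_zero]
    positivity
  · refine (H j x hx).trans ?_
    have h2 := inv_pow_mul_exp_le hκ hx j
    have hj : (0 : ℝ) < (j ! : ℕ) := by positivity
    calc (j ! : ℕ) * r ^ j * (x⁻¹ ^ j * Real.exp (-(x ^ (-κ)) / 2))
        ≤ (j ! : ℕ) * r ^ j * (((j ! : ℕ) : ℝ) ^ (1 / κ) * ((2 / κ) ^ (1 / κ)) ^ j) := by gcongr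
      _ = 1 * (r * (2 / κ) ^ (1 / κ)) ^ j * ((j ! : ℕ) : ℝ) ^ (1 + 1 / κ) := by
        rw [Real.rpow_add hj, Real.rpow_one, mul_pow]
        ring

/-- Zeros of analytic functions are isolated unless the function vanishes nearby: positive points
exclude one case, negative points the other. -/
theorem not_analyticAt_flatFun (κ : ℝ) : ¬ AnalyticAt ℝ (flatFun κ) 0 := by
  intro h
  rcases h.eventually_eq_zero_or_eventually_ne_zero with h0 | h0
  · obtain ⟨x, hx, hx0⟩ := ((h0.filter_mono nhdsWithin_le_nhds).and
      (self_mem_nhdsWithin : Set.Ioi (0 : ℝ) ∈ nhdsWithin 0 (Set.Ioi 0))).exists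
    rw [flatFun_of_pos hx0] at hx
    exact (Real.exp_pos _).ne' hx
  · have hle : nhdsWithin (0 : ℝ) (Set.Iio 0) ≤ nhdsWithin 0 {0}ᶜ :=
      nhdsWithin_mono _ fun y hy => (Set.mem_Iio.1 hy).ne
    obtain ⟨x, hx, hx0⟩ := ((h0.filter_mono hle).and
      (self_mem_nhdsWithin : Set.Iio (0 : ℝ) ∈ nhdsWithin 0 (Set.Iio 0))).exists
    exact hx (flatFun_of_nonpos (Set.mem_Iio.1 hx0).le)

/-- The flat function vanishes to infinite order at the origin. -/
lemma exists_flatFun_le_mul_pow {κ : ℝ} (hκ : 0 < κ) (m : ℕ) :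
    ∃ B : ℝ, 0 ≤ B ∧ ∀ x : ℝ, 0 ≤ x → flatFun κ x ≤ B * x ^ m := by
  refine ⟨((m ! : ℕ) : ℝ) ^ (1 / κ) * ((2 / κ) ^ (1 / κ)) ^ m, by positivity, fun x hx => ?_⟩
  rcases hx.eq_or_lt with rfl | hx
  · rw [flatFun_of_nonpos le_rfl]
    positivity
  · have h := inv_pow_mul_exp_le hκ hx m
    have h1 : flatFun κ x ≤ Real.exp (-(x ^ (-κ)) / 2) := by
      rw [flatFun_of_pos hx]
      have := Real.rpow_nonneg hx.le (-κ)
      gcongr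
      linarith
    rw [inv_pow, inv_mul_le_iff₀ (by positivity)] at h
    linarith

/-! ### Moments of flat functions and oscillatory Laplace transforms -/

open MeasureTheory Set Complex in
/-- A function that is flat at the origin stays integrable after division by powers. -/
lemma integrableOn_mul_of_flat {θ : ℝ → ℝ} (hθ : Continuous θ) (h0 : ∀ x, 0 ≤ θ x)
    (hflat : ∀ m : ℕ, ∃ B : ℝ, 0 ≤ B ∧ ∀ x : ℝ, 0 ≤ x → θ x ≤ B * x ^ m) (L : ℝ)
    {g : ℝ → ℂ} (hg : Measurable g) (m : ℕ) (hgb : ∀ y, 0 < y → ‖g y‖ ≤ y⁻¹ ^ m) :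
    IntegrableOn (fun y => (θ y : ℂ) * g y) (Ioc 0 L) := by
  obtain ⟨B, hB, H⟩ := hflat m
  refine Measure.integrableOn_of_bounded (M := B) (by simp) ?_ ?_
  · exact ((Complex.measurable_ofReal.comp hθ.measurable).mul hg).aestronglyMeasurable
  · refine (ae_restrict_mem measurableSet_Ioc).mono fun y hy => ?_
    have hy0 : 0 < y := hy.1
    rw [norm_mul, Complex.norm_real, Real.norm_of_nonneg (h0 y)]
    calc θ y * ‖g y‖ ≤ B * y ^ m * y⁻¹ ^ m :=
          mul_le_mul (H y hy0.le) (hgb y hy0) (norm_nonneg _) (by positivity)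
      _ = B := by rw [mul_assoc, ← mul_pow, mul_inv_cancel₀ hy0.ne', one_pow, mul_one]

/-- The reciprocal of the phase `y² + 2iy`. -/
def phaseInv (y : ℝ) : ℂ := ((y : ℂ) ^ 2 + 2 * y * Complex.I)⁻¹

lemma phase_re (y : ℝ) : ((y : ℂ) ^ 2 + 2 * y * Complex.I).re = y ^ 2 := by
  simp [pow_two]

lemma phase_im (y : ℝ) : ((y : ℂ) ^ 2 + 2 * y * Complex.I).im = 2 * y := by
  simp [pow_two]

lemma norm_phaseInv_le {y : ℝ} (hy : 0 < y) : ‖phaseInv y‖ ≤ y⁻¹ := by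
  rw [phaseInv, norm_inv]
  gcongr
  refine le_trans ?_ (Complex.abs_im_le_norm _)
  rw [phase_im, abs_of_pos (by positivity)]
  linarith

lemma measurable_phaseInv : Measurable phaseInv := by
  unfold phaseInv
  fun_prop

/-! ### Laplace integrals and the moments of `phaseInv` -/

open MeasureTheory Set in
lemma integral_pow_mul_exp_neg (n : ℕ) {r : ℝ} (hr : 0 < r) :
    ∫ t in Ioi (0 : ℝ), t ^ n * Real.exp (-(r * t)) = (n ! : ℕ) / r ^ (n + 1) := by
  have h := Real.integral_rpow_mul_exp_neg_mul_Ioi (a := n + 1) (r := r) (by positivity) hr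
  simp only [add_sub_cancel_right, Real.rpow_natCast] at h
  rw [h, Real.Gamma_nat_eq_factorial, show (n + 1 : ℝ) = ((n + 1 : ℕ) : ℝ) by push_cast; rfl,
    Real.rpow_natCast, one_div, inv_pow]
  ring

open MeasureTheory Set in
lemma integrableOn_pow_mul_exp_neg (n : ℕ) {r : ℝ} (hr : 0 < r) :
    IntegrableOn (fun t : ℝ => t ^ n * Real.exp (-(r * t))) (Ioi 0) := by
  have h := integrableOn_rpow_mul_exp_neg_mul_rpow (s := n) (p := 1) (b := r)
    (by linarith [(Nat.cast_nonneg n : (0 : ℝ) ≤ n)]) one_pos hr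
  simpa using h

lemma norm_pow_mul_cexp_neg (n : ℕ) (u : ℂ) {t : ℝ} (ht : 0 ≤ t) :
    ‖(t : ℂ) ^ n * Complex.exp (-(t * u))‖ = t ^ n * Real.exp (-(u.re * t)) := by
  rw [norm_mul, norm_pow, Complex.norm_real, Complex.norm_exp, Real.norm_of_nonneg ht,
    Complex.neg_re, Complex.re_ofReal_mul, mul_comm t]

open MeasureTheory Set in
lemma integrableOn_pow_mul_cexp_neg (n : ℕ) {u : ℂ} (hu : 0 < u.re) :
    IntegrableOn (fun t : ℝ => (t : ℂ) ^ n * Complex.exp (-(t * u))) (Ioi 0) := by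
  refine Integrable.mono' (integrableOn_pow_mul_exp_neg n hu) (by fun_prop) ?_
  exact (ae_restrict_mem measurableSet_Ioi).mono fun t ht =>
    (norm_pow_mul_cexp_neg n u (mem_Ioi.1 ht).le).le

open MeasureTheory Set Filter in
lemma integral_pow_mul_cexp_neg (n : ℕ) {u : ℂ} (hu : 0 < u.re) :
    ∫ t in Ioi (0 : ℝ), (t : ℂ) ^ n * Complex.exp (-(t * u)) = (n ! : ℕ) * u⁻¹ ^ (n + 1) := by
  have hu0 : u ≠ 0 := fun h => by simp [h] at hu
  induction n with
  | zero =>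
    have h := integral_exp_mul_complex_Ioi (a := -u) (by simpa using hu) 0
    have h1 : ∀ t : ℝ, (t : ℂ) ^ 0 * Complex.exp (-(t * u)) = Complex.exp (-u * t) := fun t => by
      rw [pow_zero, one_mul]
      congr 1
      ring
    simp only [h1, h]
    simp
  | succ n ih =>
    -- Integration by parts: this derivative has integral zero over the half-line, which links the
    -- integrals for `n` and `n + 1`.
    have hd : ∀ t : ℝ, HasDerivAt (fun t : ℝ => (t : ℂ) ^ (n + 1) * Complex.exp (-(t * u)))
        ((n + 1 : ℂ) * ((t : ℂ) ^ n * Complex.exp (-(t * u))) -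
          u * ((t : ℂ) ^ (n + 1) * Complex.exp (-(t * u)))) t := by
      intro t
      have h1 : HasDerivAt (fun t : ℝ => (t : ℂ)) 1 t := Complex.ofRealCLM.hasDerivAt
      refine ((h1.fun_pow (n + 1)).fun_mul ((h1.mul_const u).fun_neg.cexp)).congr_deriv ?_
      simp only [Nat.add_sub_cancel]
      push_cast
      ring
    have hlim : Tendsto (fun t : ℝ => (t : ℂ) ^ (n + 1) * Complex.exp (-(t * u))) atTop
        (nhds 0) := by
      rw [tendsto_zero_iff_norm_tendsto_zero]
      have h1 : Tendsto (fun t : ℝ => t ^ (n + 1) / Real.exp (u.re * t)) atTop (nhds 0) :=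
        (isLittleO_pow_exp_pos_mul_atTop (n + 1) hu).tendsto_div_nhds_zero
      refine h1.congr' ((eventually_ge_atTop 0).mono fun t ht => ?_)
      simp only
      rw [norm_pow_mul_cexp_neg _ _ ht, Real.exp_neg, div_eq_mul_inv]
    have h := integral_Ioi_of_hasDerivAt_of_tendsto' (a := 0) (fun t _ => hd t)
      (((integrableOn_pow_mul_cexp_neg n hu).const_mul _).sub
        ((integrableOn_pow_mul_cexp_neg (n + 1) hu).const_mul _)) hlim
    rw [integral_sub ((integrableOn_pow_mul_cexp_neg n hu).const_mul _)
        ((integrableOn_pow_mul_cexp_neg (n + 1) hu).const_mul _), integral_const_mul,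
        integral_const_mul, ih] at h
    simp only [Complex.ofReal_zero, ne_eq, Nat.add_eq_zero_iff, one_ne_zero, and_false,
      not_false_eq_true, zero_pow, zero_mul, sub_zero] at h
    rw [sub_eq_zero] at h
    refine mul_left_cancel₀ hu0 (h.symm.trans ?_)
    rw [Nat.factorial_succ, pow_succ u⁻¹ (n + 1)]
    push_cast
    field_simp

open MeasureTheory Set in
/-- Exponential decay of the oscillatory Laplace transform bounds the negative moments. -/
lemma norm_integral_mul_phaseInv_pow_le {θ : ℝ → ℝ} (hθ : Continuous θ) (h0 : ∀ x, 0 ≤ θ x)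
    (hflat : ∀ m : ℕ, ∃ B : ℝ, 0 ≤ B ∧ ∀ x : ℝ, 0 ≤ x → θ x ≤ B * x ^ m) {L δ K : ℝ}
    (hδ : 0 < δ)
    (hF : ∀ t : ℝ, 0 < t → ‖∫ y in Ioc 0 L, (θ y : ℂ) *
      Complex.exp (-(t * ((y : ℂ) ^ 2 + 2 * y * Complex.I)))‖ ≤ K * Real.exp (-(δ * t))) (n : ℕ) :
    ‖∫ y in Ioc 0 L, (θ y : ℂ) * phaseInv y ^ (n + 1)‖ ≤ K * δ⁻¹ ^ (n + 1) := by
  set f : ℝ → ℝ → ℂ := fun t y => (t : ℂ) ^ n * ((θ y : ℂ) *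
    Complex.exp (-(t * ((y : ℂ) ^ 2 + 2 * y * Complex.I)))) with hf
  have hnorm : ∀ t y : ℝ, 0 < t → ‖f t y‖ = θ y * (t ^ n * Real.exp (-(y ^ 2 * t))) := by
    intro t y ht
    have : (-(t * ((y : ℂ) ^ 2 + 2 * y * Complex.I))).re = -(y ^ 2 * t) := by
      rw [Complex.neg_re, Complex.re_ofReal_mul, phase_re, mul_comm]
    rw [hf]
    simp only
    rw [norm_mul, norm_mul, norm_pow, Complex.norm_real, Complex.norm_real, Complex.norm_exp,
      this, Real.norm_of_nonneg ht.le, Real.norm_of_nonneg (h0 y)]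
    ring
  -- Absolute integrability for Fubini: only the real part `y²` of the phase damps, so the
  -- `t`-integral of the norm is `n! θ(y) y ^ (-2(n+1))`, integrable because `θ` is flat.
  have hint : Integrable (Function.uncurry f)
      ((volume.restrict (Ioi (0 : ℝ))).prod (volume.restrict (Ioc 0 L))) := by
    have hcont : Continuous (Function.uncurry f) := by
      rw [hf]
      unfold Function.uncurry
      fun_prop
    rw [integrable_prod_iff' hcont.aestronglyMeasurable]
    constructor
    · refine (ae_restrict_mem measurableSet_Ioc).mono fun y hy => ?_
      have hy0 : 0 < y ^ 2 := by have := hy.1; positivity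
      refine Integrable.mono' ((integrableOn_pow_mul_exp_neg n hy0).const_mul (θ y)) ?_ ?_
      · exact (hcont.comp (Continuous.prodMk_left y)).aestronglyMeasurable
      · refine (ae_restrict_mem measurableSet_Ioi).mono fun t ht => ?_
        exact (hnorm t y ht).le
    · have h1 : IntegrableOn (fun y => (θ y : ℂ) * (((n ! : ℕ) : ℝ) * y⁻¹ ^ (2 * (n + 1)) : ℝ))
          (Ioc 0 L) := by
        have := (integrableOn_mul_of_flat hθ h0 hflat L
          (g := fun y => ((y⁻¹ ^ (2 * (n + 1)) : ℝ) : ℂ)) (by fun_prop) (2 * (n + 1))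
          (fun y hy => by
            rw [Complex.norm_real, Real.norm_of_nonneg (by positivity)])).const_mul
            (((n ! : ℕ) : ℝ) : ℂ)
        refine this.congr (Filter.Eventually.of_forall fun y => ?_)
        simp only
        push_cast
        ring
      refine h1.norm.congr ((ae_restrict_mem measurableSet_Ioc).mono fun y hy => ?_)
      have hy0 : 0 < y := hy.1
      have h2 : ∫ t in Ioi (0 : ℝ), ‖Function.uncurry f (t, y)‖ =
          ∫ t in Ioi (0 : ℝ), θ y * (t ^ n * Real.exp (-(y ^ 2 * t))) :=
        setIntegral_congr_fun measurableSet_Ioi fun t ht => hnorm t y ht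
      simp only
      rw [h2, integral_const_mul, integral_pow_mul_exp_neg n (by positivity), norm_mul,
        Complex.norm_real, Complex.norm_real, Real.norm_of_nonneg (h0 y),
        Real.norm_of_nonneg (by positivity), pow_mul, inv_pow, inv_pow]
      ring
  have hswap := integral_integral_swap hint
  have hR : ∫ y in Ioc 0 L, ∫ t in Ioi (0 : ℝ), f t y =
      (n ! : ℕ) * ∫ y in Ioc 0 L, (θ y : ℂ) * phaseInv y ^ (n + 1) := by
    rw [← integral_const_mul]
    refine setIntegral_congr_fun measurableSet_Ioc fun y hy => ?_
    have hy0 : 0 < y := hy.1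
    have : ∀ t : ℝ, f t y = (θ y : ℂ) * ((t : ℂ) ^ n *
        Complex.exp (-(t * ((y : ℂ) ^ 2 + 2 * y * Complex.I)))) := fun t => by
      rw [hf]
      ring
    simp only [this]
    rw [integral_const_mul, integral_pow_mul_cexp_neg n (by rw [phase_re]; positivity)]
    rw [phaseInv]
    ring
  have hLb : ‖∫ t in Ioi (0 : ℝ), ∫ y in Ioc 0 L, f t y‖ ≤ K * ((n ! : ℕ) / δ ^ (n + 1)) := by
    rw [← integral_pow_mul_exp_neg n hδ, ← integral_const_mul]
    refine norm_integral_le_of_norm_le ((integrableOn_pow_mul_exp_neg n hδ).const_mul K)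
      ((ae_restrict_mem measurableSet_Ioi).mono fun t ht => ?_)
    have ht0 : (0 : ℝ) < t := ht
    rw [hf]
    simp only
    rw [integral_const_mul, norm_mul, norm_pow, Complex.norm_real, Real.norm_of_nonneg ht0.le]
    have := mul_le_mul_of_nonneg_left (hF t ht0) (pow_nonneg ht0.le n)
    linarith
  rw [hswap, hR, norm_mul, Complex.norm_natCast] at hLb
  have hn : (0 : ℝ) < (n ! : ℕ) := by positivity
  refine le_of_mul_le_mul_left (hLb.trans_eq ?_) hn
  rw [inv_pow]
  ring

/-! ### From moments of `phaseInv` to moments of `1/y` -/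

/-- The second root `-1 / (y + 2i)` of `a² = b (1 + 2 i a)`, `b = phaseInv y`; the first is `1/y`. -/
def conjRoot (y : ℝ) : ℂ := -((y : ℂ) + 2 * Complex.I)⁻¹

lemma measurable_conjRoot : Measurable conjRoot := by
  unfold conjRoot
  fun_prop

lemma norm_conjRoot_le (y : ℝ) : ‖conjRoot y‖ ≤ 1 := by
  rw [conjRoot, norm_neg, norm_inv]
  refine inv_le_one_of_one_le₀ (le_trans ?_ (Complex.abs_im_le_norm _))
  simp

lemma add_two_I_ne_zero (y : ℝ) : (y : ℂ) + 2 * Complex.I ≠ 0 := fun h => by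
  simpa using congrArg Complex.im h

lemma phaseInv_eq (y : ℝ) : phaseInv y = (y : ℂ)⁻¹ * ((y : ℂ) + 2 * Complex.I)⁻¹ := by
  rw [phaseInv, ← mul_inv]
  congr 1
  ring

lemma inv_add_conjRoot {y : ℝ} (hy : 0 < y) :
    (y : ℂ)⁻¹ + conjRoot y = 2 * Complex.I * phaseInv y := by
  have hy' : (y : ℂ) ≠ 0 := by exact_mod_cast hy.ne'
  have := add_two_I_ne_zero y
  rw [phaseInv_eq, conjRoot]
  field_simp
  ring

lemma inv_mul_conjRoot (y : ℝ) : (y : ℂ)⁻¹ * conjRoot y = - phaseInv y := by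
  rw [phaseInv_eq, conjRoot]
  ring

open MeasureTheory Set in
/-- The power sums of the two roots are polynomials in `phaseInv`, so that their moments inherit
the bounds for the moments of `phaseInv`. -/
lemma norm_integral_powerSum_le {θ : ℝ → ℝ} (hθ : Continuous θ) (h0 : ∀ x, 0 ≤ θ x)
    (hflat : ∀ m : ℕ, ∃ B : ℝ, 0 ≤ B ∧ ∀ x : ℝ, 0 ≤ x → θ x ≤ B * x ^ m) {L M ρ : ℝ}
    (hρ : 0 ≤ ρ) (hM : ∀ k : ℕ, ‖∫ y in Ioc 0 L, (θ y : ℂ) * phaseInv y ^ k‖ ≤ M * ρ ^ k)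
    (n : ℕ) : ∀ k : ℕ,
    ‖∫ y in Ioc 0 L, (θ y : ℂ) * (phaseInv y ^ k * ((y : ℂ)⁻¹ ^ n + conjRoot y ^ n))‖ ≤
      2 * M * ρ ^ k * (2 * ρ + 1) ^ n := by
  have hM0 : 0 ≤ M := by simpa using (norm_nonneg _).trans (hM 0)
  have hint : ∀ k n : ℕ, IntegrableOn (fun y => (θ y : ℂ) *
      (phaseInv y ^ k * ((y : ℂ)⁻¹ ^ n + conjRoot y ^ n))) (Ioc 0 L) := by
    intro k n
    have h1 := integrableOn_mul_of_flat hθ h0 hflat L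
      (g := fun y => phaseInv y ^ k * (y : ℂ)⁻¹ ^ n)
      (by have := measurable_phaseInv; fun_prop) (k + n) (fun y hy => by
        rw [norm_mul, norm_pow, norm_pow, norm_inv, Complex.norm_real, Real.norm_of_nonneg hy.le,
          pow_add]
        have := norm_phaseInv_le hy
        gcongr)
    have h2 := integrableOn_mul_of_flat hθ h0 hflat L
      (g := fun y => phaseInv y ^ k * conjRoot y ^ n)
      (by have := measurable_phaseInv; have := measurable_conjRoot; fun_prop) k (fun y hy => by
        rw [norm_mul, norm_pow, norm_pow]
        have h3 := norm_phaseInv_le hy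
        calc ‖phaseInv y‖ ^ k * ‖conjRoot y‖ ^ n ≤ y⁻¹ ^ k * 1 := by
              gcongr
              exact pow_le_one₀ (norm_nonneg _) (norm_conjRoot_le y)
          _ = _ := mul_one _)
    refine (h1.add h2).congr (Filter.Eventually.of_forall fun y => ?_)
    simp only [Pi.add_apply]
    ring
  induction n using Nat.twoStepInduction with
  | zero =>
    intro k
    have : ∀ y : ℝ, (θ y : ℂ) * (phaseInv y ^ k * ((y : ℂ)⁻¹ ^ 0 + conjRoot y ^ 0)) =
        2 * ((θ y : ℂ) * phaseInv y ^ k) := fun y => by ring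
    simp only [this]
    rw [integral_const_mul, norm_mul, Complex.norm_ofNat]
    linarith [hM k]
  | one =>
    intro k
    have : ∀ y ∈ Ioc 0 L, (θ y : ℂ) * (phaseInv y ^ k * ((y : ℂ)⁻¹ ^ 1 + conjRoot y ^ 1)) =
        (2 * Complex.I) * ((θ y : ℂ) * phaseInv y ^ (k + 1)) := fun y hy => by
      rw [pow_one, pow_one, inv_add_conjRoot hy.1]
      ring
    rw [setIntegral_congr_fun measurableSet_Ioc this, integral_const_mul, norm_mul, norm_mul,
      Complex.norm_ofNat, Complex.norm_I]
    have h1 := hM (k + 1)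
    have h2 : 0 ≤ M * ρ ^ k := by positivity
    rw [pow_succ] at h1
    nlinarith
  | more n ih0 ih1 =>
    intro k
    -- Newton's recurrence for the power sums. It raises the power of `phaseInv`, so the induction
    -- runs over all `k` at once; the rate `2ρ + 1` works because `2ρ(2ρ + 1) + ρ ≤ (2ρ + 1)²`.
    have : ∀ y ∈ Ioc 0 L,
        (θ y : ℂ) * (phaseInv y ^ k * ((y : ℂ)⁻¹ ^ (n + 2) + conjRoot y ^ (n + 2))) =
        (2 * Complex.I) * ((θ y : ℂ) * (phaseInv y ^ (k + 1) *
          ((y : ℂ)⁻¹ ^ (n + 1) + conjRoot y ^ (n + 1)))) +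
        (θ y : ℂ) * (phaseInv y ^ (k + 1) * ((y : ℂ)⁻¹ ^ n + conjRoot y ^ n)) := fun y hy => by
      have h1 := inv_add_conjRoot hy.1
      have h2 := inv_mul_conjRoot y
      linear_combination (θ y : ℂ) * phaseInv y ^ k * (((y : ℂ)⁻¹ ^ (n + 1) +
        conjRoot y ^ (n + 1)) * h1 - ((y : ℂ)⁻¹ ^ n + conjRoot y ^ n) * h2)
    rw [setIntegral_congr_fun measurableSet_Ioc this,
      integral_add ((hint (k + 1) (n + 1)).const_mul _) (hint (k + 1) n), integral_const_mul]
    refine (norm_add_le _ _).trans ?_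
    rw [norm_mul, norm_mul, Complex.norm_ofNat, Complex.norm_I]
    have h1 := ih1 (k + 1)
    have h2 := ih0 (k + 1)
    have h3 : 0 ≤ M * ρ ^ k * (2 * ρ + 1) ^ n := by positivity
    rw [pow_succ] at h1 h2
    rw [pow_succ (2 * ρ + 1) n] at h1
    rw [pow_add]
    nlinarith

open MeasureTheory Set in
-- The power sum contributes `2M`; removing the `conjRoot` term costs at most `∫ θ ≤ M`, as that
-- root has modulus at most `1`.
lemma integral_mul_inv_pow_le {θ : ℝ → ℝ} (hθ : Continuous θ) (h0 : ∀ x, 0 ≤ θ x)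
    (hflat : ∀ m : ℕ, ∃ B : ℝ, 0 ≤ B ∧ ∀ x : ℝ, 0 ≤ x → θ x ≤ B * x ^ m) {L M ρ : ℝ}
    (hρ : 0 ≤ ρ) (hM : ∀ k : ℕ, ‖∫ y in Ioc 0 L, (θ y : ℂ) * phaseInv y ^ k‖ ≤ M * ρ ^ k)
    (n : ℕ) : ∫ y in Ioc 0 L, θ y * y⁻¹ ^ n ≤ 3 * M * (2 * ρ + 1) ^ n := by
  have hM0 : 0 ≤ M := by simpa using (norm_nonneg _).trans (hM 0)
  have h1 := integrableOn_mul_of_flat hθ h0 hflat L (g := fun y => (y : ℂ)⁻¹ ^ n)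
    (by fun_prop) n (fun y hy => by
      rw [norm_pow, norm_inv, Complex.norm_real, Real.norm_of_nonneg hy.le])
  have h2 := integrableOn_mul_of_flat hθ h0 hflat L (g := fun y => conjRoot y ^ n)
    (by have := measurable_conjRoot; fun_prop) 0 (fun y hy => by
      rw [norm_pow]
      simpa using pow_le_one₀ (norm_nonneg _) (norm_conjRoot_le y))
  have h3 := norm_integral_powerSum_le hθ h0 hflat hρ hM n 0
  have hsplit : ∀ y : ℝ, (θ y : ℂ) * (phaseInv y ^ 0 * ((y : ℂ)⁻¹ ^ n + conjRoot y ^ n)) =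
      (θ y : ℂ) * (y : ℂ)⁻¹ ^ n + (θ y : ℂ) * conjRoot y ^ n := fun y => by ring
  simp only [hsplit] at h3
  rw [integral_add h1 h2] at h3
  have h4 : ‖∫ y in Ioc 0 L, (θ y : ℂ) * conjRoot y ^ n‖ ≤ M := by
    have hθi : IntegrableOn θ (Ioc 0 L) := hθ.integrableOn_Ioc
    have h5 : ‖∫ y in Ioc 0 L, (θ y : ℂ) * conjRoot y ^ n‖ ≤ ∫ y in Ioc 0 L, θ y := by
      refine norm_integral_le_of_norm_le hθi (Filter.Eventually.of_forall fun y => ?_)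
      rw [norm_mul, norm_pow, Complex.norm_real, Real.norm_of_nonneg (h0 y)]
      exact mul_le_of_le_one_right (h0 y) (pow_le_one₀ (norm_nonneg _) (norm_conjRoot_le y))
    have h6 := hM 0
    simp only [pow_zero, mul_one] at h6
    rw [integral_complex_ofReal, Complex.norm_real] at h6
    exact h5.trans ((le_abs_self _).trans h6)
  have h5 : ∫ y in Ioc 0 L, (θ y : ℂ) * (y : ℂ)⁻¹ ^ n =
      ((∫ y in Ioc 0 L, θ y * y⁻¹ ^ n : ℝ) : ℂ) := by
    rw [← integral_complex_ofReal]
    push_cast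
    rfl
  have h6 : ‖∫ y in Ioc 0 L, (θ y : ℂ) * (y : ℂ)⁻¹ ^ n‖ ≤ 3 * M * (2 * ρ + 1) ^ n := by
    have h7 : (1 : ℝ) ≤ (2 * ρ + 1) ^ n := one_le_pow₀ (by linarith)
    have h8 := norm_sub_norm_le (∫ y in Ioc 0 L, (θ y : ℂ) * (y : ℂ)⁻¹ ^ n)
      (-∫ y in Ioc 0 L, (θ y : ℂ) * conjRoot y ^ n)
    rw [sub_neg_eq_add, norm_neg] at h8
    rw [pow_zero, mul_one] at h3
    nlinarith
  rw [h5, Complex.norm_real] at h6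
  exact (le_abs_self _).trans h6

open MeasureTheory Set in
/-- The oscillatory Laplace transform of a flat positive amplitude does not decay
exponentially. -/
theorem not_forall_norm_integral_le {θ : ℝ → ℝ} (hθ : Continuous θ) (h0 : ∀ x, 0 ≤ θ x)
    (hpos : ∀ x, 0 < x → 0 < θ x)
    (hflat : ∀ m : ℕ, ∃ B : ℝ, 0 ≤ B ∧ ∀ x : ℝ, 0 ≤ x → θ x ≤ B * x ^ m) {L δ : ℝ}
    (hL : 0 < L) (hδ : 0 < δ) (K : ℝ) :
    ¬ ∀ t : ℝ, 0 < t → ‖∫ y in Ioc 0 L, (θ y : ℂ) *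
      Complex.exp (-(t * ((y : ℂ) ^ 2 + 2 * y * Complex.I)))‖ ≤ K * Real.exp (-(δ * t)) := by
  intro hF
  -- The Laplace argument covers only positive powers of `phaseInv`; the maximum takes care of `k =
  -- 0`.
  set M : ℝ := max K ‖∫ y in Ioc 0 L, (θ y : ℂ)‖ with hM
  have hMk : ∀ k : ℕ, ‖∫ y in Ioc 0 L, (θ y : ℂ) * phaseInv y ^ k‖ ≤ M * δ⁻¹ ^ k := by
    rintro (_ | k)
    · simp only [pow_zero, mul_one]
      exact le_max_right _ _
    · refine (norm_integral_mul_phaseInv_pow_le hθ h0 hflat hδ hF k).trans ?_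
      gcongr
      exact le_max_left _ _
  set R : ℝ := 2 * δ⁻¹ + 1 with hR
  have hR0 : 0 < R := by positivity
  have hmom := integral_mul_inv_pow_le hθ h0 hflat (inv_nonneg.2 hδ.le) hMk
  -- On `(0, ε]` one has `y⁻¹ ≥ 2R`, so the moments grow at least like `c (2R) ^ n`, against an
  -- upper bound of order `R ^ n`.
  set ε : ℝ := min L (2 * R)⁻¹ with hε
  have hε0 : 0 < ε := lt_min hL (by positivity)
  set c : ℝ := ∫ y in Ioc 0 ε, θ y with hc
  have hc0 : 0 < c := by
    rw [hc, ← intervalIntegral.integral_of_le hε0.le]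
    exact intervalIntegral.intervalIntegral_pos_of_pos_on (hθ.intervalIntegrable _ _)
      (fun x hx => hpos x hx.1) hε0
  have hlow : ∀ n : ℕ, c * (2 * R) ^ n ≤ 3 * M * R ^ n := by
    intro n
    refine le_trans ?_ (hmom n)
    have hint : IntegrableOn (fun y => θ y * y⁻¹ ^ n) (Ioc 0 L) := by
      have h1 := integrableOn_mul_of_flat hθ h0 hflat L (g := fun y => (y : ℂ)⁻¹ ^ n)
        (by fun_prop) n (fun y hy => by
          rw [norm_pow, norm_inv, Complex.norm_real, Real.norm_of_nonneg hy.le])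
      refine h1.re.congr (Filter.Eventually.of_forall fun y => ?_)
      simp only
      norm_cast
    have hsub : Ioc 0 ε ⊆ Ioc 0 L := Ioc_subset_Ioc_right (min_le_left _ _)
    have h2 : ∫ y in Ioc 0 ε, θ y * y⁻¹ ^ n ≤ ∫ y in Ioc 0 L, θ y * y⁻¹ ^ n := by
      refine setIntegral_mono_set hint ?_ hsub.eventuallyLE
      refine (ae_restrict_mem measurableSet_Ioc).mono fun y hy => ?_
      have := h0 y
      have := hy.1
      simp only [Pi.zero_apply]
      positivity
    refine le_trans ?_ h2
    rw [hc, ← integral_mul_const]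
    refine setIntegral_mono_on (hθ.integrableOn_Ioc.mul_const _) (hint.mono_set hsub)
      measurableSet_Ioc fun y hy => ?_
    have hy0 : 0 < y := hy.1
    have hRy : 2 * R ≤ y⁻¹ := by
      refine (le_inv_comm₀ (by positivity) hy0).2 ?_
      exact hy.2.trans (min_le_right _ _)
    have := h0 y
    gcongr
  have hlow2 : ∀ n : ℕ, (2 : ℝ) ^ n ≤ 3 * M / c := by
    intro n
    have h := hlow n
    rw [mul_pow, ← mul_assoc] at h
    have h' := le_of_mul_le_mul_right h (by positivity : 0 < R ^ n)
    rw [le_div_iff₀ hc0]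
    linarith
  obtain ⟨n, hn⟩ := pow_unbounded_of_one_lt (3 * M / c) (one_lt_two : (1 : ℝ) < 2)
  exact absurd (hlow2 n) (not_le.2 hn)

/-! ### Solutions of the triangular system -/

/-- The solution `exp ((x² / 2 + i x) / h)` of `h φ' = (x + i) φ`. -/
def growth (h x : ℝ) : ℂ := Complex.exp ((h⁻¹ : ℝ) * ((x : ℂ) ^ 2 / 2 + x * Complex.I))

/-- The oscillatory primitive of `θ` with large parameter `t`. -/
def oscPrimitive (θ : ℝ → ℝ) (t x : ℝ) : ℂ :=
  ∫ y in (0 : ℝ)..x, (θ y : ℂ) * Complex.exp (-(t * ((y : ℂ) ^ 2 + 2 * y * Complex.I)))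

/-- The solution of the triangular system with value `(a, b)` at the origin. -/
def triangularSol (p : ℝ) (θ : ℝ → ℝ) (h : ℝ) (a b : ℂ) (x : ℝ) : Fin 2 → ℂ :=
  ![growth h x * (a + b * (((h ^ (p - 1) : ℝ) : ℂ) * oscPrimitive θ h⁻¹ x)), b * (growth h x)⁻¹]

lemma growth_ne_zero (h x : ℝ) : growth h x ≠ 0 := Complex.exp_ne_zero _

lemma growth_zero (h : ℝ) : growth h 0 = 1 := by simp [growth]

lemma norm_growth (h x : ℝ) : ‖growth h x‖ = Real.exp (h⁻¹ * x ^ 2 / 2) := by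
  rw [growth, Complex.norm_exp, Complex.re_ofReal_mul]
  congr 1
  rw [Complex.add_re, Complex.re_ofReal_mul, Complex.I_re, ← Complex.ofReal_pow,
    Complex.div_ofNat_re, Complex.ofReal_re]
  ring

lemma norm_growth_mul_self (h x : ℝ) :
    ‖growth h x‖ * ‖growth h x‖ = Real.exp (h⁻¹ * x ^ 2) := by
  rw [norm_growth, ← Real.exp_add]
  ring_nf

lemma hasDerivAt_growth (h x : ℝ) :
    HasDerivAt (growth h) (growth h x * ((h⁻¹ : ℝ) * (x + Complex.I))) x := by
  have h1 : HasDerivAt (fun x : ℝ => (x : ℂ)) 1 x := Complex.ofRealCLM.hasDerivAt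
  refine ((((h1.fun_pow 2).div_const 2).fun_add (h1.mul_const Complex.I)).const_mul
    ((h⁻¹ : ℝ) : ℂ)).cexp.congr_deriv ?_
  rw [growth]
  push_cast
  ring

lemma oscPrimitive_zero (θ : ℝ → ℝ) (t : ℝ) : oscPrimitive θ t 0 = 0 := by simp [oscPrimitive]

lemma hasDerivAt_oscPrimitive {θ : ℝ → ℝ} (hθ : Continuous θ) (h x : ℝ) :
    HasDerivAt (oscPrimitive θ h⁻¹) ((θ x : ℂ) * ((growth h x)⁻¹ * (growth h x)⁻¹)) x := by
  have hc : Continuous fun y : ℝ =>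
      (θ y : ℂ) * Complex.exp (-((h⁻¹ : ℝ) * ((y : ℂ) ^ 2 + 2 * y * Complex.I))) := by fun_prop
  refine (intervalIntegral.integral_hasDerivAt_right (hc.intervalIntegrable _ _)
    (hc.stronglyMeasurableAtFilter _ _) hc.continuousAt).congr_deriv ?_
  rw [growth, ← Complex.exp_neg, ← Complex.exp_add]
  congr 2
  ring

lemma triangularSol_zero (p : ℝ) (θ : ℝ → ℝ) (h : ℝ) (a b : ℂ) :
    triangularSol p θ h a b 0 = ![a, b] := by
  simp [triangularSol, growth_zero, oscPrimitive_zero]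

/-- The Wronskian is constant because the coefficient matrix has trace zero. -/
lemma wronskian_triangularSol (p : ℝ) (θ : ℝ → ℝ) (h : ℝ) (a b a' b' : ℂ) (x : ℝ) :
    triangularSol p θ h a b x 0 * triangularSol p θ h a' b' x 1 -
      triangularSol p θ h a b x 1 * triangularSol p θ h a' b' x 0 = a * b' - a' * b := by
  have := growth_ne_zero h x
  simp only [triangularSol, Matrix.cons_val_zero, Matrix.cons_val_one]
  field_simp
  ring

lemma solvesOn_triangularSol (p : ℝ) {θ : ℝ → ℝ} (hθ : Continuous θ) {h : ℝ} (hh : 0 < h) (L : ℝ)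
    (a b : ℂ) : SolvesOn h L (triangularCoeff p θ h) (triangularSol p θ h a b) := by
  intro x _
  have hhc : (h : ℂ) ≠ 0 := by exact_mod_cast hh.ne'
  have hg := growth_ne_zero h x
  have h1 := (hasDerivAt_growth h x).fun_mul
    ((((hasDerivAt_oscPrimitive hθ h x).const_mul ((h ^ (p - 1) : ℝ) : ℂ)).const_mul b).const_add a)
  have h2 := ((hasDerivAt_growth h x).fun_inv hg).const_mul b
  have hp : h ^ p = h * h ^ (p - 1) := by
    rw [Real.rpow_sub_one hh.ne']
    field_simp
  refine ⟨(h : ℂ)⁻¹ • (triangularCoeff p θ h x).mulVec (triangularSol p θ h a b x), ?_, by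
    rw [smul_smul, mul_inv_cancel₀ hhc, one_smul]⟩
  refine HasDerivAt.hasDerivWithinAt (hasDerivAt_pi.2
    (Fin.forall_fin_two.2 ⟨h1.congr_deriv ?_, h2.congr_deriv ?_⟩))
  all_goals
    simp only [triangularCoeff, triangularSol, Matrix.mulVec, dotProduct, Fin.sum_univ_two,
      Pi.smul_apply, smul_eq_mul, Matrix.cons_val_zero, Matrix.cons_val_one, Matrix.of_apply,
      Matrix.cons_val', Matrix.cons_val_fin_one, hp]
    push_cast
    field_simp
    try ring

/-! ### Rows of the diagonalised system -/

open Set in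
lemma hasDerivWithinAt_normSq {g : ℝ → ℂ} {g' : ℂ} {s : Set ℝ} {x : ℝ}
    (hg : HasDerivWithinAt g g' s x) :
    HasDerivWithinAt (fun y => Complex.normSq (g y)) (2 * ((starRingEnd ℂ) (g x) * g').re) s x := by
  have h1 := Complex.reCLM.hasFDerivAt.comp_hasDerivWithinAt x hg
  have h2 := Complex.imCLM.hasFDerivAt.comp_hasDerivWithinAt x hg
  refine ((h1.mul h1).add (h2.mul h2)).congr_deriv ?_
  simp
  ring

open Set in
/-- Two solutions of one scalar linear equation without common zeros have constant ratio. -/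
lemma eq_zero_of_common_logDeriv {h a c x₀ : ℝ} (hh : h ≠ 0) {d g k : ℝ → ℂ}
    (hg : ∀ x ∈ Icc a c, ∃ g', HasDerivWithinAt g g' (Icc a c) x ∧ (h : ℂ) * g' = d x * g x)
    (hk : ∀ x ∈ Icc a c, ∃ k', HasDerivWithinAt k k' (Icc a c) x ∧ (h : ℂ) * k' = d x * k x)
    (hne : ∀ x ∈ Icc a c, g x = 0 → k x ≠ 0) (hx₀ : x₀ ∈ Icc a c) (h0 : g x₀ = 0) :
    ∀ x ∈ Icc a c, g x = 0 := by
  have hN : ∀ x ∈ Icc a c, Complex.normSq (g x) + Complex.normSq (k x) ≠ 0 := by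
    intro x hx hsum
    have h1 := Complex.normSq_nonneg (g x)
    have h2 := Complex.normSq_nonneg (k x)
    exact hne x hx (Complex.normSq_eq_zero.1 (by linarith)) (Complex.normSq_eq_zero.1 (by linarith))
  have hsq : ∀ f : ℝ → ℂ, (∀ x ∈ Icc a c, ∃ f', HasDerivWithinAt f f' (Icc a c) x ∧
      (h : ℂ) * f' = d x * f x) → ∀ x ∈ Icc a c, HasDerivWithinAt
      (fun y => Complex.normSq (f y)) (2 * (d x / h).re * Complex.normSq (f x)) (Icc a c) x := by
    intro f hf x hx
    obtain ⟨f', hf', he⟩ := hf x hx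
    have hhc : (h : ℂ) ≠ 0 := by exact_mod_cast hh
    have he' : f' = d x / h * f x := by
      field_simp
      linear_combination he
    refine (hasDerivWithinAt_normSq hf').congr_deriv ?_
    rw [he', show (starRingEnd ℂ) (f x) * (d x / h * f x) = d x / h * (f x * (starRingEnd ℂ) (f x))
      by ring, Complex.mul_conj, Complex.re_mul_ofReal]
    ring
  -- Both squared moduli satisfy the same real linear equation, so this quotient has derivative
  -- zero. Its denominator never vanishes, and no regularity of `d` is required.
  set q : ℝ → ℝ := fun x => Complex.normSq (g x) / (Complex.normSq (g x) + Complex.normSq (k x))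
    with hq
  have hd : ∀ x ∈ Icc a c, HasDerivWithinAt q 0 (Icc a c) x := by
    intro x hx
    refine ((hsq g hg x hx).fun_div ((hsq g hg x hx).fun_add (hsq k hk x hx))
      (hN x hx)).congr_deriv ?_
    rw [div_eq_zero_iff]
    left
    ring
  have hconst : ∀ x ∈ Icc a c, q x = q a := by
    refine constant_of_derivWithin_zero (fun x hx => (hd x hx).differentiableWithinAt) ?_
    intro x hx
    exact (hd x (Ico_subset_Icc_self hx)).derivWithin
      (uniqueDiffOn_Icc (hx.1.trans_lt hx.2) x (Ico_subset_Icc_self hx))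
  intro x hx
  have h1 : q x = 0 := by
    rw [hconst x hx, ← hconst x₀ hx₀, hq]
    simp [h0]
  rw [hq] at h1
  simpa [div_eq_zero_iff, hN x hx] using h1

open Set in
/-- Each component of a solution of a diagonal system solves a scalar equation. -/
lemma SolvesOn.component {h L : ℝ} {D : ℝ → Matrix (Fin 2) (Fin 2) ℂ}
    (hD : ∀ x ∈ Icc (-L) L, (D x).IsDiag) {Z : ℝ → Fin 2 → ℂ} (hZ : SolvesOn h L D Z) (i : Fin 2) :
    ∀ x ∈ Icc (-L) L, ∃ z', HasDerivWithinAt (fun y => Z y i) z' (Icc (-L) L) x ∧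
      (h : ℂ) * z' = D x i i * Z x i := by
  intro x hx
  obtain ⟨W', hW', he⟩ := hZ x hx
  refine ⟨W' i, hasDerivWithinAt_pi.1 hW' i, ?_⟩
  have h1 := congrFun he i
  rw [Pi.smul_apply, smul_eq_mul] at h1
  rw [h1, Matrix.mulVec, dotProduct, Finset.sum_eq_single i]
  · intro j _ hj
    rw [hD x hx hj.symm, zero_mul]
  · simp

open Set in
lemma SolvesOn.congr {h L : ℝ} {M : ℝ → Matrix (Fin 2) (Fin 2) ℂ} {W V : ℝ → Fin 2 → ℂ}
    (hW : SolvesOn h L M W) (hVW : ∀ x ∈ Icc (-L) L, V x = W x) : SolvesOn h L M V := by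
  intro x hx
  obtain ⟨W', hW', he⟩ := hW x hx
  exact ⟨W', hW'.congr hVW (hVW x hx), by rw [hVW x hx, he]⟩

open Set in
/-- Each component of the new coordinates vanishes identically along a suitable solution. -/
lemma exists_component_eq_zero {p : ℝ} {θ : ℝ → ℝ} (hθ : Continuous θ) {h L : ℝ} (hh : 0 < h)
    (hL : 0 < L) {D T : ℝ → Matrix (Fin 2) (Fin 2) ℂ} (hT : ∀ x ∈ Icc (-L) L, IsUnit (T x))
    (hD : ∀ x ∈ Icc (-L) L, (D x).IsDiag) (hconv : ConvertsOn h L (triangularCoeff p θ h) D T)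
    (i : Fin 2) : ∃ a b : ℂ, (a ≠ 0 ∨ b ≠ 0) ∧
      ∀ x ∈ Icc (-L) L, ((T x)⁻¹.mulVec (triangularSol p θ h a b x)) i = 0 := by
  have hdet : ∀ x ∈ Icc (-L) L, IsUnit (T x).det := fun x hx =>
    (Matrix.isUnit_iff_isUnit_det _).1 (hT x hx)
  have hZ : ∀ a b : ℂ, SolvesOn h L D (fun x => (T x)⁻¹.mulVec (triangularSol p θ h a b x)) := by
    intro a b
    refine (hconv _).1 ((solvesOn_triangularSol p hθ hh L a b).congr fun x hx => ?_)
    rw [Matrix.mulVec_mulVec, Matrix.mul_nonsing_inv _ (hdet x hx), Matrix.one_mulVec]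
  have hrow : ∀ x ∈ Icc (-L) L, ¬ ((T x)⁻¹ i 0 = 0 ∧ (T x)⁻¹ i 1 = 0) := by
    rintro x hx ⟨h0, h1⟩
    have h2 : ((T x)⁻¹).det = 0 :=
      Matrix.det_eq_zero_of_row_eq_zero i (Fin.forall_fin_two.2 ⟨h0, h1⟩)
    exact (Matrix.isUnit_nonsing_inv_det _ (hdet x hx)).ne_zero h2
  have h0mem : (0 : ℝ) ∈ Icc (-L) L := ⟨by linarith, hL.le⟩
  set r := (T 0)⁻¹ i 0 with hr
  set s := (T 0)⁻¹ i 1 with hs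
  have hrs : r * (starRingEnd ℂ) r + s * (starRingEnd ℂ) s ≠ 0 := by
    rw [Complex.mul_conj, Complex.mul_conj, ← Complex.ofReal_add, Complex.ofReal_ne_zero]
    intro hsum
    have h1 := Complex.normSq_nonneg r
    have h2 := Complex.normSq_nonneg s
    exact hrow 0 h0mem ⟨Complex.normSq_eq_zero.1 (by linarith),
      Complex.normSq_eq_zero.1 (by linarith)⟩
  -- The row `(r, s)` of the inverse at `0` annihilates `(s, -r)`. The comparison solution starts at
  -- the conjugate row, so the Wronskian is `|r|² + |s|² ≠ 0`; a common zero of both coordinates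
  -- would make row `i` of the inverse vanish.
  refine ⟨s, -r, ?_, ?_⟩
  · by_contra! hc
    exact hrow 0 h0mem ⟨neg_eq_zero.1 hc.2, hc.1⟩
  · refine eq_zero_of_common_logDeriv hh.ne' ((hZ s (-r)).component hD i)
      ((hZ ((starRingEnd ℂ) r) ((starRingEnd ℂ) s)).component hD i) ?_ h0mem ?_
    · intro x hx hg hk
      have hw := wronskian_triangularSol p θ h s (-r) ((starRingEnd ℂ) r) ((starRingEnd ℂ) s) x
      simp only [Matrix.mulVec, dotProduct, Fin.sum_univ_two] at hg hk
      have hne : s * (starRingEnd ℂ) s - (starRingEnd ℂ) r * -r ≠ 0 := by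
        convert! hrs using 1
        ring
      rw [← hw] at hne
      refine hrow x hx ⟨?_, ?_⟩
      · refine mul_right_cancel₀ hne ?_
        linear_combination triangularSol p θ h ((starRingEnd ℂ) r) ((starRingEnd ℂ) s) x 1 * hg -
          triangularSol p θ h s (-r) x 1 * hk
      · refine mul_right_cancel₀ hne ?_
        linear_combination triangularSol p θ h s (-r) x 0 * hk -
          triangularSol p θ h ((starRingEnd ℂ) r) ((starRingEnd ℂ) s) x 0 * hg
    · rw [triangularSol_zero]
      simp only [Matrix.mulVec, dotProduct, Fin.sum_univ_two, Matrix.cons_val_zero,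
        Matrix.cons_val_one, ← hr, ← hs]
      ring

open Set in
/-- A bounded conjugator provides two solutions that are transversal, uniformly in `x`. -/
lemma exists_transversal_solutions {p : ℝ} {θ : ℝ → ℝ} (hθ : Continuous θ) {h L C : ℝ}
    (hh : 0 < h) (hL : 0 < L) {D T : ℝ → Matrix (Fin 2) (Fin 2) ℂ}
    (hT : ∀ x ∈ Icc (-L) L, IsUnit (T x))
    (hC : ∀ x ∈ Icc (-L) L, ∀ i j, ‖T x i j‖ ≤ C ∧ ‖(T x)⁻¹ i j‖ ≤ C)
    (hD : ∀ x ∈ Icc (-L) L, (D x).IsDiag) (hconv : ConvertsOn h L (triangularCoeff p θ h) D T) :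
    ∃ a b a' b' : ℂ, a * b' - a' * b ≠ 0 ∧ ∀ x ∈ Icc (-L) L, ∀ i j,
      ‖triangularSol p θ h a b x i * triangularSol p θ h a' b' x j‖ ≤
        2 * C ^ 4 * ‖a * b' - a' * b‖ := by
  obtain ⟨a, b, hab, h0⟩ := exists_component_eq_zero hθ hh hL hT hD hconv 0
  obtain ⟨a', b', hab', h1⟩ := exists_component_eq_zero hθ hh hL hT hD hconv 1
  have hdet : ∀ x ∈ Icc (-L) L, IsUnit (T x).det := fun x hx =>
    (Matrix.isUnit_iff_isUnit_det _).1 (hT x hx)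
  -- With one new coordinate zero, each solution is a multiple of a single column of `T x`.
  have hcol : ∀ x ∈ Icc (-L) L, ∃ z z' : ℂ,
      (∀ i, triangularSol p θ h a b x i = T x i 1 * z) ∧
      (∀ j, triangularSol p θ h a' b' x j = T x j 0 * z') := by
    intro x hx
    refine ⟨((T x)⁻¹.mulVec (triangularSol p θ h a b x)) 1,
      ((T x)⁻¹.mulVec (triangularSol p θ h a' b' x)) 0, fun i => ?_, fun j => ?_⟩
    · have h2 : triangularSol p θ h a b x =
          (T x).mulVec ((T x)⁻¹.mulVec (triangularSol p θ h a b x)) := by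
        rw [Matrix.mulVec_mulVec, Matrix.mul_nonsing_inv _ (hdet x hx), Matrix.one_mulVec]
      refine (congrFun h2 i).trans ?_
      rw [Matrix.mulVec, dotProduct, Fin.sum_univ_two, h0 x hx, mul_zero, zero_add]
    · have h2 : triangularSol p θ h a' b' x =
          (T x).mulVec ((T x)⁻¹.mulVec (triangularSol p θ h a' b' x)) := by
        rw [Matrix.mulVec_mulVec, Matrix.mul_nonsing_inv _ (hdet x hx), Matrix.one_mulVec]
      refine (congrFun h2 j).trans ?_
      rw [Matrix.mulVec, dotProduct, Fin.sum_univ_two, h1 x hx, mul_zero, add_zero]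
  have hw : ∀ x ∈ Icc (-L) L, ∀ z z' : ℂ,
      (∀ i, triangularSol p θ h a b x i = T x i 1 * z) →
      (∀ j, triangularSol p θ h a' b' x j = T x j 0 * z') →
      a * b' - a' * b = -((T x).det * (z * z')) := by
    intro x hx z z' hz hz'
    rw [← wronskian_triangularSol p θ h a b a' b' x, hz, hz, hz', hz', Matrix.det_fin_two]
    ring
  refine ⟨a, b, a', b', ?_, ?_⟩
  · have h0mem : (0 : ℝ) ∈ Icc (-L) L := ⟨by linarith, hL.le⟩
    obtain ⟨z, z', hz, hz'⟩ := hcol 0 h0mem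
    rw [hw 0 h0mem z z' hz hz']
    simp only [triangularSol_zero, Fin.forall_fin_two, Matrix.cons_val_zero,
      Matrix.cons_val_one] at hz hz'
    refine neg_ne_zero.2 (mul_ne_zero (hdet 0 h0mem).ne_zero (mul_ne_zero ?_ ?_))
    · rintro rfl
      simp_all
    · rintro rfl
      simp_all
  · intro x hx i j
    obtain ⟨z, z', hz, hz'⟩ := hcol x hx
    -- The Wronskian fixes the product of the two multipliers: `2 C²` comes from the inverse
    -- determinant, and the column entries give another `C²`.
    have hzz : z * z' = -(((T x)⁻¹).det * (a * b' - a' * b)) := by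
      have h2 : ((T x)⁻¹).det * (T x).det = 1 := by
        rw [← Matrix.det_mul, Matrix.nonsing_inv_mul _ (hdet x hx), Matrix.det_one]
      rw [hw x hx z z' hz hz']
      linear_combination -(z * z') * h2
    have hC0 : 0 ≤ C := (norm_nonneg _).trans (hC x hx 0 0).1
    have hdetC : ‖((T x)⁻¹).det‖ ≤ 2 * C ^ 2 := by
      rw [Matrix.det_fin_two]
      refine (norm_sub_le _ _).trans ?_
      rw [norm_mul, norm_mul]
      have e1 := mul_le_mul (hC x hx 0 0).2 (hC x hx 1 1).2 (norm_nonneg _) hC0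
      have e2 := mul_le_mul (hC x hx 0 1).2 (hC x hx 1 0).2 (norm_nonneg _) hC0
      linarith
    calc ‖triangularSol p θ h a b x i * triangularSol p θ h a' b' x j‖
        = ‖T x i 1‖ * ‖T x j 0‖ * (‖((T x)⁻¹).det‖ * ‖a * b' - a' * b‖) := by
          rw [hz, hz', show T x i 1 * z * (T x j 0 * z') = T x i 1 * T x j 0 * (z * z') by ring,
            hzz, norm_mul, norm_mul, norm_neg, norm_mul]
      _ ≤ C * C * (2 * C ^ 2 * ‖a * b' - a' * b‖) := by
          gcongr
          · exact (hC x hx i 1).1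
          · exact (hC x hx j 0).1
      _ = 2 * C ^ 4 * ‖a * b' - a' * b‖ := by ring

/-! ### Absence of bounded conjugators -/

/-- Transversality of two solutions at `-L`, `0`, `L` forces the connection coefficient `j` to be
small. -/
lemma norm_connection_le {a b a' b' j : ℂ} {K ε : ℝ} (hK : 1 ≤ K) (hε : 0 ≤ ε)
    (hω : a * b' - a' * b ≠ 0) (h1 : ‖a * a'‖ ≤ K * ε * ‖a * b' - a' * b‖)
    (h2 : ‖(a + b * j) * (a' + b' * j)‖ ≤ K * ε * ‖a * b' - a' * b‖)
    (h3 : ‖b * b'‖ ≤ K * ‖a * b' - a' * b‖) (hεK : 16 * K ^ 2 * ε ≤ 1) (hj : 4 * K * ‖j‖ ≤ 1) :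
    ‖j‖ ≤ 8 * K * ε := by
  set ω := a * b' - a' * b with hωdef
  set s := a * b' + a' * b with hs
  have hω0 : 0 < ‖ω‖ := norm_pos_iff.2 hω
  -- Since `ω² = s² - 4 (a a')(b b')` and the last product is small, `s` is comparable to `ω`.
  have hs2 : ‖ω‖ ^ 2 ≤ ‖s‖ ^ 2 + 4 * (‖a * a'‖ * ‖b * b'‖) := by
    have : ω ^ 2 = s ^ 2 - 4 * ((a * a') * (b * b')) := by rw [hωdef, hs]; ring
    calc ‖ω‖ ^ 2 = ‖s ^ 2 - 4 * ((a * a') * (b * b'))‖ := by rw [← norm_pow, this]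
      _ ≤ ‖s ^ 2‖ + ‖4 * ((a * a') * (b * b'))‖ := norm_sub_le _ _
      _ = _ := by rw [norm_pow, norm_mul, norm_mul, Complex.norm_ofNat]
  have hprod : ‖a * a'‖ * ‖b * b'‖ ≤ K * ε * ‖ω‖ * (K * ‖ω‖) :=
    mul_le_mul h1 h3 (norm_nonneg _) (by positivity)
  have hs1 : ‖ω‖ / 2 ≤ ‖s‖ := by
    refine le_of_sq_le_sq ?_ (norm_nonneg _)
    have h4 : 16 * K ^ 2 * ε * ‖ω‖ ^ 2 ≤ 1 * ‖ω‖ ^ 2 := by gcongr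
    nlinarith
  -- `s` is the linear coefficient of `(a + b j)(a' + b' j)` in `j`; the quadratic term is absorbed
  -- through `4 K ‖j‖ ≤ 1`.
  have hsj : ‖s‖ * ‖j‖ ≤ 2 * (K * ε * ‖ω‖) + K * ‖ω‖ * ‖j‖ ^ 2 := by
    have : s * j = (a + b * j) * (a' + b' * j) - a * a' - b * b' * j ^ 2 := by rw [hs]; ring
    rw [← norm_mul, this]
    refine (norm_sub_le _ _).trans ?_
    have h5 := norm_sub_le ((a + b * j) * (a' + b' * j)) (a * a')
    have h6 : ‖b * b' * j ^ 2‖ ≤ K * ‖ω‖ * ‖j‖ ^ 2 := by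
      rw [norm_mul, norm_pow]
      gcongr
    linarith
  have h7 : ‖ω‖ / 2 * ‖j‖ ≤ ‖s‖ * ‖j‖ := by gcongr
  have h8 : 4 * K * ‖j‖ * (‖ω‖ * ‖j‖) ≤ 1 * (‖ω‖ * ‖j‖) := by gcongr
  have h9 : ‖ω‖ * ‖j‖ ≤ ‖ω‖ * (8 * K * ε) := by nlinarith
  exact le_of_mul_le_mul_left h9 hω0

/-! ### A priori bounds and the contradiction -/

open MeasureTheory Set in
-- Supplies the a priori smallness of the connection coefficient, also for `p = 1`, where the
-- prefactor `h ^ (p - 1)` gives none. It rests on `s * exp (-s) ≤ 1` with `s = t y²`.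
lemma norm_oscPrimitive_le {θ : ℝ → ℝ} (h0 : ∀ x, 0 ≤ θ x) {B L : ℝ} (hB : 0 ≤ B) (hL : 0 ≤ L)
    (hθ2 : ∀ x : ℝ, 0 ≤ x → θ x ≤ B * x ^ 2) {t : ℝ} (ht : 0 < t) :
    ‖oscPrimitive θ t L‖ ≤ B * L / t := by
  have h1 : ‖oscPrimitive θ t L‖ ≤ B / t * |L - 0| := by
    refine intervalIntegral.norm_integral_le_of_norm_le_const fun y hy => ?_
    rw [uIoc_of_le hL] at hy
    have hre : (-(t * ((y : ℂ) ^ 2 + 2 * y * Complex.I))).re = -(t * y ^ 2) := by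
      rw [Complex.neg_re, Complex.re_ofReal_mul, phase_re]
    rw [norm_mul, Complex.norm_real, Real.norm_of_nonneg (h0 y), Complex.norm_exp, hre]
    have h2 : t * y ^ 2 * Real.exp (-(t * y ^ 2)) ≤ 1 := by
      have h3 := Real.add_one_le_exp (t * y ^ 2)
      rw [Real.exp_neg, ← div_eq_mul_inv, div_le_one (Real.exp_pos _)]
      linarith
    rw [le_div_iff₀ ht]
    calc θ y * Real.exp (-(t * y ^ 2)) * t ≤ B * y ^ 2 * Real.exp (-(t * y ^ 2)) * t := by
          gcongr
          exact hθ2 y hy.1.le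
      _ = B * (t * y ^ 2 * Real.exp (-(t * y ^ 2))) := by ring
      _ ≤ B * 1 := by gcongr
      _ = B := mul_one B
  rw [sub_zero, abs_of_nonneg hL] at h1
  exact h1.trans_eq (by ring)

open MeasureTheory Set in
lemma norm_oscPrimitive_le_const {θ : ℝ → ℝ} (h0 : ∀ x, 0 ≤ θ x) {B L : ℝ} (hL : 0 ≤ L)
    (hθB : ∀ x, θ x ≤ B) {t : ℝ} (ht : 0 < t) : ‖oscPrimitive θ t L‖ ≤ B * L := by
  have h1 : ‖oscPrimitive θ t L‖ ≤ B * |L - 0| := by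
    refine intervalIntegral.norm_integral_le_of_norm_le_const fun y hy => ?_
    have hre : (-(t * ((y : ℂ) ^ 2 + 2 * y * Complex.I))).re = -(t * y ^ 2) := by
      rw [Complex.neg_re, Complex.re_ofReal_mul, phase_re]
    rw [norm_mul, Complex.norm_real, Real.norm_of_nonneg (h0 y), Complex.norm_exp, hre]
    refine (mul_le_of_le_one_right (h0 y) ?_).trans (hθB y)
    rw [Real.exp_le_one_iff]
    have : 0 ≤ t * y ^ 2 := by positivity
    linarith
  rwa [sub_zero, abs_of_nonneg hL] at h1

lemma oscPrimitive_of_nonpos {θ : ℝ → ℝ} (hθ0 : ∀ x, x ≤ 0 → θ x = 0) (t : ℝ) {x : ℝ}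
    (hx : x ≤ 0) : oscPrimitive θ t x = 0 := by
  rw [oscPrimitive]
  refine intervalIntegral.integral_zero_ae (Filter.Eventually.of_forall fun y hy => ?_)
  rw [Set.uIoc_of_ge hx] at hy
  rw [hθ0 y hy.2]
  simp

open Set in
/-- A bounded conjugator makes the connection coefficient exponentially small. -/
lemma norm_connection_le_of_conjugator {p : ℝ} {θ : ℝ → ℝ} (hθ : Continuous θ)
    (hθ0 : ∀ x, x ≤ 0 → θ x = 0) {h L C K : ℝ}
    (hh : 0 < h) (hL : 0 < L) {D T : ℝ → Matrix (Fin 2) (Fin 2) ℂ}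
    (hT : ∀ x ∈ Icc (-L) L, IsUnit (T x))
    (hC : ∀ x ∈ Icc (-L) L, ∀ i j, ‖T x i j‖ ≤ C ∧ ‖(T x)⁻¹ i j‖ ≤ C)
    (hD : ∀ x ∈ Icc (-L) L, (D x).IsDiag) (hconv : ConvertsOn h L (triangularCoeff p θ h) D T)
    (hK1 : 1 ≤ K) (hKC : 2 * C ^ 4 ≤ K) (hεK : 16 * K ^ 2 * Real.exp (-(L ^ 2 * h⁻¹)) ≤ 1)
    (hj : 4 * K * (h ^ (p - 1) * ‖oscPrimitive θ h⁻¹ L‖) ≤ 1) :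
    h ^ (p - 1) * ‖oscPrimitive θ h⁻¹ L‖ ≤ 8 * K * Real.exp (-(L ^ 2 * h⁻¹)) := by
  obtain ⟨a, b, a', b', hω, H⟩ := exists_transversal_solutions hθ hh hL hT hC hD hconv
  have HK : ∀ x ∈ Icc (-L) L, ∀ i j,
      ‖triangularSol p θ h a b x i * triangularSol p θ h a' b' x j‖ ≤
        K * ‖a * b' - a' * b‖ := fun x hx i j => (H x hx i j).trans (by gcongr)
  have hnorm : ‖((h ^ (p - 1) : ℝ) : ℂ) * oscPrimitive θ h⁻¹ L‖ =
      h ^ (p - 1) * ‖oscPrimitive θ h⁻¹ L‖ := by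
    rw [norm_mul, Complex.norm_real, Real.norm_of_nonneg (Real.rpow_nonneg hh.le _)]
  have hgrow : ∀ (x : ℝ), x ^ 2 = L ^ 2 → ∀ u v : ℂ,
      ‖(growth h x * u) * (growth h x * v)‖ ≤ K * ‖a * b' - a' * b‖ →
      ‖u * v‖ ≤ K * Real.exp (-(L ^ 2 * h⁻¹)) * ‖a * b' - a' * b‖ := by
    intro x hx u v huv
    rw [show (growth h x * u) * (growth h x * v) = growth h x * growth h x * (u * v) by ring,
      norm_mul, norm_mul, norm_growth_mul_self, hx] at huv
    have hE : Real.exp (-(L ^ 2 * h⁻¹)) * Real.exp (h⁻¹ * L ^ 2) = 1 := by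
      rw [← Real.exp_add, ← Real.exp_zero]
      congr 1
      ring
    calc ‖u * v‖ = Real.exp (-(L ^ 2 * h⁻¹)) * (Real.exp (h⁻¹ * L ^ 2) * ‖u * v‖) := by
          rw [← mul_assoc, hE, one_mul]
      _ ≤ Real.exp (-(L ^ 2 * h⁻¹)) * (K * ‖a * b' - a' * b‖) := by gcongr
      _ = _ := by ring
  rw [← hnorm] at hj ⊢
  refine norm_connection_le hK1 (Real.exp_pos _).le hω ?_ ?_ ?_ hεK hj
  -- The primitive vanishes at `-L`, so the upper components there are just `growth` times `a` and
  -- `a'`; at `L` they contain the connection coefficient.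
  · refine hgrow (-L) (by ring) a a' ?_
    have := HK (-L) ⟨le_rfl, by linarith⟩ 0 0
    simpa [triangularSol, oscPrimitive_of_nonpos hθ0 h⁻¹ (neg_nonpos.2 hL.le)] using this
  · refine hgrow L rfl _ _ ?_
    simpa only [triangularSol, Matrix.cons_val_zero] using HK L ⟨by linarith, le_rfl⟩ 0 0
  · have := HK 0 ⟨by linarith, hL.le⟩ 1 1
    simpa only [triangularSol_zero, Matrix.cons_val_one, Matrix.cons_val_fin_one] using this

open Set Filter in
/-- The triangular system with flat positive coupling has no uniformly bounded conjugator. -/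
theorem not_exists_isBoundedC1Conjugator {θ : ℝ → ℝ} (hθ : Continuous θ) (h0 : ∀ x, 0 ≤ θ x)
    (hpos : ∀ x, 0 < x → 0 < θ x) (hθ0 : ∀ x, x ≤ 0 → θ x = 0) (hθ1 : ∀ x, θ x ≤ 1)
    (hflat : ∀ m : ℕ, ∃ B : ℝ, 0 ≤ B ∧ ∀ x : ℝ, 0 ≤ x → θ x ≤ B * x ^ m) {p : ℝ} (hp : 1 ≤ p)
    {L : ℝ} (hL : 0 < L) :
    ¬ ∃ (h₀ : ℝ) (T : ℝ → ℝ → Matrix (Fin 2) (Fin 2) ℂ), 0 < h₀ ∧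
      IsBoundedC1Conjugator (triangularCoeff p θ) L h₀ T := by
  rintro ⟨h₀, T, hh₀, hconj⟩
  obtain ⟨C, hC⟩ := hconj.bounded
  obtain ⟨B, hB, hθ2⟩ := hflat 2
  set K : ℝ := max 1 (2 * C ^ 4) with hK
  have hK1 : 1 ≤ K := le_max_left _ _
  have hexp : Tendsto (fun t : ℝ => 16 * K ^ 2 * Real.exp (-(L ^ 2 * t))) atTop (nhds 0) := by
    have h1 : Tendsto (fun t : ℝ => L ^ 2 * t) atTop atTop :=
      tendsto_id.const_mul_atTop (by positivity)
    simpa using (Real.tendsto_exp_neg_atTop_nhds_zero.comp h1).const_mul (16 * K ^ 2)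
  have hdiv : Tendsto (fun t : ℝ => 4 * K * (B * L / t)) atTop (nhds 0) := by
    simpa using (tendsto_const_nhds.div_atTop tendsto_id : Tendsto (fun t : ℝ => B * L / t) atTop
      (nhds 0)).const_mul (4 * K)
  -- Half of the exponential rate `L²` is given up to absorb the factor `t ^ (p - 1)`.
  have hpow : ∀ᶠ t : ℝ in atTop, t ^ (p - 1) ≤ Real.exp (L ^ 2 / 2 * t) := by
    have h1 := (isLittleO_rpow_exp_pos_mul_atTop (p - 1)
      (by positivity : 0 < L ^ 2 / 2)).bound one_pos
    filter_upwards [h1] with t ht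
    rw [one_mul, Real.norm_of_nonneg (Real.exp_pos _).le] at ht
    exact (le_abs_self _).trans ht
  have hev : ∀ᶠ t : ℝ in atTop,
      ‖oscPrimitive θ t L‖ ≤ 8 * K * Real.exp (-(L ^ 2 / 2 * t)) := by
    filter_upwards [hexp.eventually (ge_mem_nhds one_pos), hdiv.eventually (ge_mem_nhds one_pos),
      hpow, eventually_ge_atTop 1, eventually_ge_atTop h₀⁻¹] with t h1 h2 h3 h4 h5
    have ht : 0 < t := by linarith
    have hmem : t⁻¹ ∈ Ioc 0 h₀ := ⟨by positivity, inv_le_of_inv_le₀ hh₀ h5⟩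
    obtain ⟨D, hD, hconv⟩ := hconj.diagonalizes t⁻¹ hmem
    have hpow1 : t⁻¹ ^ (p - 1) ≤ 1 :=
      Real.rpow_le_one (by positivity) (inv_le_one_of_one_le₀ h4) (by linarith)
    have key := norm_connection_le_of_conjugator hθ hθ0 hmem.1 hL (hconj.invertible _ hmem)
      (hC _ hmem) hD hconv hK1 (le_max_right _ _) (by rw [inv_inv]; exact h1) (by
        rw [inv_inv]
        refine le_trans ?_ h2
        gcongr
        refine (mul_le_of_le_one_left (norm_nonneg _) hpow1).trans ?_
        exact norm_oscPrimitive_le h0 hB hL.le hθ2 ht)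
    rw [inv_inv, Real.inv_rpow ht.le, inv_mul_le_iff₀ (by positivity)] at key
    calc ‖oscPrimitive θ t L‖ ≤ t ^ (p - 1) * (8 * K * Real.exp (-(L ^ 2 * t))) := key
      _ ≤ Real.exp (L ^ 2 / 2 * t) * (8 * K * Real.exp (-(L ^ 2 * t))) := by gcongr
      _ = 8 * K * (Real.exp (L ^ 2 / 2 * t) * Real.exp (-(L ^ 2 * t))) := by ring
      _ = 8 * K * Real.exp (-(L ^ 2 / 2 * t)) := by
        rw [← Real.exp_add]
        congr 2
        ring
  obtain ⟨t₀, ht₀⟩ := eventually_atTop.1 hev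
  -- The second entry of the maximum extends the decay to `0 < t ≤ t₀`, where the transform is
  -- merely bounded by `L`.
  refine not_forall_norm_integral_le hθ h0 hpos hflat hL (by positivity : 0 < L ^ 2 / 2)
    (max (8 * K) (L * Real.exp (L ^ 2 / 2 * t₀))) fun t ht => ?_
  have hosc : ‖oscPrimitive θ t L‖ ≤
      max (8 * K) (L * Real.exp (L ^ 2 / 2 * t₀)) * Real.exp (-(L ^ 2 / 2 * t)) := by
    rcases le_total t₀ t with h1 | h1
    · refine (ht₀ t h1).trans ?_
      gcongr
      exact le_max_left _ _
    · have h2 := norm_oscPrimitive_le_const h0 hL.le hθ1 ht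
      calc ‖oscPrimitive θ t L‖ ≤ L * 1 := by linarith
        _ ≤ L * (Real.exp (L ^ 2 / 2 * t₀) * Real.exp (-(L ^ 2 / 2 * t))) := by
          gcongr
          rw [← Real.exp_add, Real.one_le_exp_iff]
          have : L ^ 2 / 2 * t ≤ L ^ 2 / 2 * t₀ := by gcongr
          linarith
        _ = L * Real.exp (L ^ 2 / 2 * t₀) * Real.exp (-(L ^ 2 / 2 * t)) := by ring
        _ ≤ _ := by
          gcongr
          exact le_max_right _ _
  rwa [oscPrimitive, intervalIntegral.integral_of_le hL.le] at hosc

end SemiclassicalConjugator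

end

theorem corollary1p7 (κ : ℝ) (hκ : 0 < κ) :
    ContDiff ℝ (⊤ : ℕ∞) (SemiclassicalConjugator.flatFun κ) ∧
    SemiclassicalConjugator.IsGevrey (1 + 1 / κ) (SemiclassicalConjugator.flatFun κ) ∧
    ¬ AnalyticAt ℝ (SemiclassicalConjugator.flatFun κ) 0 ∧
    ∀ (p : ℝ), 1 ≤ p → ∀ (L : ℝ), 0 < L →
      ¬ ∃ (h₀ : ℝ) (T : ℝ → ℝ → Matrix (Fin 2) (Fin 2) ℂ), 0 < h₀ ∧
        SemiclassicalConjugator.IsBoundedC1Conjugator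
          (SemiclassicalConjugator.triangularCoeff p (SemiclassicalConjugator.flatFun κ))
          L h₀ T := by
  open SemiclassicalConjugator in
  exact ⟨contDiff_flatFun hκ, isGevrey_flatFun hκ, not_analyticAt_flatFun κ, fun p hp L hL =>
    not_exists_isBoundedC1Conjugator (contDiff_flatFun hκ).continuous (flatFun_nonneg κ)
      (fun x hx => (flatFun_of_pos hx).symm ▸ Real.exp_pos _) (fun x hx => flatFun_of_nonpos hx)
      (flatFun_le_one κ) (exists_flatFun_le_mul_pow hκ) hp hL⟩
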